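/- Let $V$ be a finite-dimensional vector space over a field $F$ with a quadratic form $Q\colon V\to F$ and polar form $B(x,y)=Q(x+y)-Q(x)-Q(y)$. Put $V^\perp=\{x\in V\mid B(x,y)=0 \text{ for all } y\in V\}$. Let $\mathrm{Cl}=\mathrm{Cl}(V,Q)$ be the Clifford algebra, with even part $\mathrm{Cl}_0$, odd part $\mathrm{Cl}_1$, and main involution $\sigma$ (the algebra endomorphism with $\sigma(x)=-x$ for $x\in V$). Let $\mathrm{Lip}^\times$ be the group of units of the multiplicative submonoid of $\mathrm{Cl}$ generated by $F$, $V$ and all $1+st$ with $s,t\in V$, $Q(s)=Q(t)=B(s,t)=0$. Let $\mathcal G=\{Fp\mid p\in \mathrm{Lip}^\times\}\cong \mathrm{Lip}^\times/F^\times$, a group of one-dimensional subspaces ("points") of $\mathrm{Cl}$ under $(Fp)(Fq)=F(pq)$, and let $\mathcal G_i=\{P\in\mathcal G\mid P\subseteq \mathrm{Cl}_i\}$ for $i=0,1$. Let $\mathrm O'$ be the group of all linear bijections $\varphi$ of $V$ with $Q\circ\varphi=Q$ that fix $V^\perp$ elementwise, $\mathrm I'=\mathrm O'\cap\{\mathrm{id}_V,-\mathrm{id}_V\}$,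 and $\mathrm{PO}'=\mathrm O'/\mathrm I'$. For $p\in\mathrm{Lip}^\times$ let $\xi_p\in \mathrm O'$ be the map $x\mapsto p\,x\,\sigma(p)^{-1}$, and let $\theta\colon\mathcal G\to \mathrm{PO}'$ be the homomorphism $Fp\mapsto \mathrm I'\circ\xi_p$. **Theorem.** Suppose that $\dim V^\perp=0$. Then $\theta$ is surjective and has the following properties. (a) If $\dim V=0$, then $\ker\theta=\{F1\}$ and $\mathcal G_0=\mathcal G$; in particular $\theta(\mathcal G_0)=\mathrm{PO}'$. (b) If $\dim V>0$ and $\operatorname{char}F=2$, then $\ker\theta=\{F1\}$ and $\theta(\mathcal G_0)\neq \mathrm{PO}'$. (c) If $\dim V$ is odd and $\operatorname{char}F\neq2$, then $V$ has a basis that is orthogonal with respect to $B$, and for every such basis $e_0,\dots,e_n$ with product $e=e_0e_1\cdots e_n$ in $\mathrm{Cl}$, the kernel of $\theta$ consists of precisely two points, $F1\in\mathcal G_0$ and $Fe\in\mathcal G_1$. Furthermore $\theta(\mathcal G_0)=\mathrm{PO}'$. (d) If $\dim V>0$ is even and $\operatorname{char}F\neq2$, then $V$ has a basis that is orthogonal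 with respect to $B$, and for every such basis with product $e$ as in (c), the kernel of $\theta$ consists of precisely two points, $F1$ and $Fe$, both in $\mathcal G_0$. Furthermore $\theta(\mathcal G_0)\neq \mathrm{PO}'$. -/

import Mathlib

namespace ProjMetric

variable {F V : Type*} [Field F] [AddCommGroup V] [Module F V]

/-! ### Metric vector spaces -/

/-- The polar form `B(x, y) = Q(x + y) - Q(x) - Q(y)`. -/
abbrev polarForm (Q : QuadraticForm F V) : LinearMap.BilinForm F V := QuadraticMap.polarBilin Q

/-- `V^⊥`, the radical of the polar form `B` (not the radical of `Q`): all `x` with `B(x, y) = 0`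
for every `y`. -/
def perpSpace (Q : QuadraticForm F V) : Submodule F V := LinearMap.ker (polarForm Q)

theorem mem_perpSpace {Q : QuadraticForm F V} {x : V} :
    x ∈ perpSpace Q ↔ ∀ y, QuadraticMap.polar Q x y = 0 := by
  simp [perpSpace, LinearMap.ext_iff]

/-- The weak orthogonal group `O'(V, Q)`: all isometries of `(V, Q)` onto itself that fix `V^⊥`
elementwise. -/
def weakOrthogonalGroup (Q : QuadraticForm F V) : Subgroup (V ≃ₗ[F] V) where
  carrier := {φ | (∀ x, Q (φ x) = Q x) ∧ ∀ x ∈ perpSpace Q, φ x = x}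
  one_mem' := ⟨fun _ => rfl, fun _ _ => rfl⟩
  mul_mem' := by
    rintro φ ψ ⟨h1, h2⟩ ⟨h3, h4⟩
    refine ⟨fun x => ?_, fun x hx => ?_⟩
    · rw [LinearEquiv.mul_apply, h1, h3]
    · rw [LinearEquiv.mul_apply, h4 x hx, h2 x hx]
  inv_mem' := by
    rintro φ ⟨h1, h2⟩
    refine ⟨fun x => ?_, fun x hx => ?_⟩
    · have h := h1 (φ.symm x)
      rw [LinearEquiv.apply_symm_apply] at h
      exact h.symm
    · have h := congrArg φ.symm (h2 x hx)
      rw [LinearEquiv.symm_apply_apply] at h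
      exact h.symm

/-- `I'(V, Q) = O'(V, Q) ∩ {id, -id}`, as a subgroup of `O'(V, Q)`. -/
def weakScalars (Q : QuadraticForm F V) : Subgroup (weakOrthogonalGroup Q) where
  carrier := {φ | (φ : V ≃ₗ[F] V) = LinearEquiv.refl F V ∨ (φ : V ≃ₗ[F] V) = LinearEquiv.neg F}
  one_mem' := Or.inl rfl
  mul_mem' := by
    rintro φ ψ (h1 | h1) (h2 | h2)
    · left; ext x; simp [h1, h2]
    · right; ext x; simp [h1, h2]
    · right; ext x; simp [h1, h2]
    · left; ext x; simp [h1, h2]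
  inv_mem' := by
    rintro φ (h | h)
    · left
      rw [InvMemClass.coe_inv, h]; rfl
    · right
      rw [InvMemClass.coe_inv, h]; rfl

theorem mem_weakScalars {Q : QuadraticForm F V} {φ : weakOrthogonalGroup Q} :
    φ ∈ weakScalars Q ↔ (φ : V ≃ₗ[F] V) = LinearEquiv.refl F V ∨
      (φ : V ≃ₗ[F] V) = LinearEquiv.neg F := Iff.rfl

instance weakScalars_normal (Q : QuadraticForm F V) : (weakScalars Q).Normal where
  conj_mem := by
    rintro φ (h | h) ψ
    · left
      have : φ = 1 := Subtype.ext h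
      subst this
      simp only [mul_one, mul_inv_cancel]; rfl
    · right
      rw [Subgroup.coe_mul, Subgroup.coe_mul, h]
      ext x
      have h' : (ψ : V ≃ₗ[F] V) (((ψ⁻¹ : weakOrthogonalGroup Q) : V ≃ₗ[F] V) x) = x :=
        (ψ : V ≃ₗ[F] V).apply_symm_apply x
      simp only [LinearEquiv.mul_apply, LinearEquiv.neg_apply, map_neg, h']

/-- The projective weak orthogonal group `PO'(V, Q) = O'(V, Q) / I'(V, Q)`. -/
abbrev ProjWeakOrthogonalGroup (Q : QuadraticForm F V) : Type _ :=
  weakOrthogonalGroup Q ⧸ weakScalars Q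

/-! ### The Lipschitz monoid and the Lipschitz group -/

open CliffordAlgebra

/-- The Lipschitz monoid: the multiplicative submonoid of the Clifford algebra that is generated
by `F`, by `V`, and by all `1 + s t` with `s, t ∈ V` and `Q(s) = Q(t) = B(s, t) = 0`. -/
def lipMonoid (Q : QuadraticForm F V) : Submonoid (CliffordAlgebra Q) :=
  Submonoid.closure
    (Set.range (algebraMap F (CliffordAlgebra Q)) ∪ Set.range (ι Q) ∪
      {m | ∃ s t : V, Q s = 0 ∧ Q t = 0 ∧ polarForm Q s t = 0 ∧ m = 1 + ι Q s * ι Q t})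

/-- The Lipschitz group `Lip^×(V, Q)`: the units of the Lipschitz monoid. -/
def lipGroup (Q : QuadraticForm F V) : Subgroup (CliffordAlgebra Q)ˣ := (lipMonoid Q).units

theorem exists_changeForm_zero (Q : QuadraticForm F V) :
    ∃ B : LinearMap.BilinForm F V, LinearMap.BilinMap.toQuadraticMap B = 0 - Q := by
  obtain ⟨B, hB⟩ := LinearMap.BilinMap.toQuadraticMap_surjective (R := F) (M := V) (N := F) (-Q)
  exact ⟨B, by rw [hB, zero_sub]⟩

/-- `V` embeds into its Clifford algebra, in every characteristic. -/
theorem ι_injective (Q : QuadraticForm F V) : Function.Injective (ι Q) := by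
  obtain ⟨B, h⟩ := exists_changeForm_zero Q
  intro x y hxy
  have h' := congrArg (changeForm h) hxy
  rw [changeForm_ι, changeForm_ι] at h'
  exact (ExteriorAlgebra.ι_leftInverse (R := F) (M := V)).injective h'

instance nontrivial_cliffordAlgebra (Q : QuadraticForm F V) : Nontrivial (CliffordAlgebra Q) := by
  obtain ⟨B, h⟩ := exists_changeForm_zero Q
  refine ⟨0, 1, fun h01 => ?_⟩
  have h' := congrArg (changeForm h) h01
  rw [map_zero, changeForm_one] at h'
  exact zero_ne_one (α := ExteriorAlgebra F V) h'

theorem reverse_mem_lipMonoid {Q : QuadraticForm F V} {m : CliffordAlgebra Q}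
    (hm : m ∈ lipMonoid Q) : reverse m ∈ lipMonoid Q := by
  induction hm using Submonoid.closure_induction with
  | mem m hm =>
    apply Submonoid.subset_closure
    rcases hm with (⟨c, rfl⟩ | ⟨v, rfl⟩) | ⟨s, t, hs, ht, hst, rfl⟩
    · left; left; exact ⟨c, by simp⟩
    · left; right; exact ⟨v, by simp⟩
    · right
      refine ⟨t, s, ht, hs, ?_, by simp⟩
      simpa [QuadraticMap.polar_comm] using hst
  | one => rw [reverse.map_one]; exact one_mem _
  | mul a b _ _ ha hb => rw [reverse.map_mul]; exact mul_mem hb ha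

theorem exists_mul_reverse {Q : QuadraticForm F V} {m : CliffordAlgebra Q}
    (hm : m ∈ lipMonoid Q) :
    ∃ c : F, m * reverse m = algebraMap F (CliffordAlgebra Q) c := by
  induction hm using Submonoid.closure_induction with
  | mem m hm =>
    rcases hm with (⟨c, rfl⟩ | ⟨v, rfl⟩) | ⟨s, t, hs, ht, hst, rfl⟩
    · exact ⟨c * c, by simp⟩
    · exact ⟨Q v, by simp⟩
    · refine ⟨1, ?_⟩
      have h1 : ι Q t * ι Q t = 0 := by rw [ι_sq_scalar, ht, map_zero]
      have h2 : ι Q s * ι Q t + ι Q t * ι Q s = 0 := by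
        rw [ι_mul_ι_add_swap]
        have : QuadraticMap.polar Q s t = 0 := by simpa using hst
        rw [this, map_zero]
      have h3 : ι Q s * ι Q t * (ι Q t * ι Q s) = 0 := by
        rw [mul_assoc, ← mul_assoc (ι Q t), h1, zero_mul, mul_zero]
      simp only [map_add, reverse.map_mul, reverse_ι, reverse.map_one, map_one]
      rw [mul_add, add_mul, add_mul, h3]
      simp only [one_mul, mul_one, add_zero]
      rw [add_assoc, h2, add_zero]
  | one => exact ⟨1, by simp⟩
  | mul a b _ _ ha hb =>
    obtain ⟨c, hc⟩ := ha
    obtain ⟨d, hd⟩ := hb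
    refine ⟨c * d, ?_⟩
    rw [reverse.map_mul, mul_assoc, ← mul_assoc b, hd, Algebra.commutes d, ← mul_assoc, hc,
      ← map_mul]

/-- For a unit `u` of the Clifford algebra that lies in the Lipschitz monoid, `u⁻¹` is a scalar
multiple of the reversal of `u`. -/
theorem exists_inv_eq_reverse {Q : QuadraticForm F V} {u : (CliffordAlgebra Q)ˣ}
    (hu : (u : CliffordAlgebra Q) ∈ lipMonoid Q) :
    ∃ c : F, ((u⁻¹ : (CliffordAlgebra Q)ˣ) : CliffordAlgebra Q) =
      algebraMap F (CliffordAlgebra Q) c * reverse (u : CliffordAlgebra Q) := by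
  obtain ⟨c, hc⟩ := exists_mul_reverse hu
  have h : reverse (u : CliffordAlgebra Q) =
      ((u⁻¹ : (CliffordAlgebra Q)ˣ) : CliffordAlgebra Q) * algebraMap F (CliffordAlgebra Q) c := by
    rw [← hc, Units.inv_mul_cancel_left]
  by_cases h0 : c = 0
  · exfalso
    rw [h0, map_zero, mul_zero] at h
    have h' : (u : CliffordAlgebra Q) = 0 := by
      rw [← reverse_reverse (u : CliffordAlgebra Q), h, map_zero]
    exact u.ne_zero h'
  · refine ⟨c⁻¹, ?_⟩
    rw [h, ← Algebra.commutes c, ← mul_assoc, ← map_mul, inv_mul_cancel₀ h0, map_one, one_mul]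

/-- The Lipschitz group consists of all elements of the Lipschitz monoid that are invertible in
the Clifford algebra: their inverses lie in the monoid automatically. -/
theorem mem_lipGroup {Q : QuadraticForm F V} {u : (CliffordAlgebra Q)ˣ} :
    u ∈ lipGroup Q ↔ (u : CliffordAlgebra Q) ∈ lipMonoid Q := by
  constructor
  · exact fun h => h.1
  · intro h
    refine ⟨h, ?_⟩
    change ((u⁻¹ : (CliffordAlgebra Q)ˣ) : CliffordAlgebra Q) ∈ lipMonoid Q
    obtain ⟨c, hc⟩ := exists_inv_eq_reverse h
    rw [hc]
    exact mul_mem (Submonoid.subset_closure (Or.inl (Or.inl ⟨c, rfl⟩))) (reverse_mem_lipMonoid h)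

/-! ### The twisted adjoint representation -/

theorem mul_ι_mul_involute_reverse_mem {Q : QuadraticForm F V} {m : CliffordAlgebra Q}
    (hm : m ∈ lipMonoid Q) :
    ∀ x : V, m * ι Q x * involute (reverse m) ∈ LinearMap.range (ι Q) := by
  induction hm using Submonoid.closure_induction with
  | mem m hm =>
    intro x
    rcases hm with (⟨c, rfl⟩ | ⟨v, rfl⟩) | ⟨s, t, hs, ht, hst, rfl⟩
    · refine ⟨c • c • x, ?_⟩
      simp only [reverse.commutes, AlgHom.commutes, map_smul]
      rw [← Algebra.commutes, ← Algebra.smul_def, ← Algebra.smul_def]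
    · rw [reverse_ι, involute_ι, mul_neg, ι_mul_ι_mul_ι]
      exact neg_mem ⟨_, rfl⟩
    · have h2 : ι Q s * ι Q t = -(ι Q t * ι Q s) := by
        refine eq_neg_of_add_eq_zero_left ?_
        rw [ι_mul_ι_add_swap]
        have : QuadraticMap.polar Q s t = 0 := by simpa using hst
        rw [this, map_zero]
      have h4 : ι Q s * ι Q t * ι Q x + ι Q x * (ι Q t * ι Q s) =
          ι Q (QuadraticMap.polar Q t x • s - QuadraticMap.polar Q s x • t) := by
        have e1 : ι Q s * ι Q t * ι Q x = ι Q s * algebraMap F _ (QuadraticMap.polar Q t x)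
            - ι Q s * ι Q x * ι Q t := by
          rw [mul_assoc, ι_mul_ι_comm t x, mul_sub, mul_assoc]
        have e2 : ι Q s * ι Q x * ι Q t = algebraMap F _ (QuadraticMap.polar Q s x) * ι Q t
            - ι Q x * (ι Q s * ι Q t) := by
          rw [ι_mul_ι_comm s x, sub_mul, mul_assoc]
        rw [e1, e2, h2, map_sub, map_smul, map_smul, ← Algebra.commutes, Algebra.smul_def,
          Algebra.smul_def]
        noncomm_ring
      have h5 : ι Q s * ι Q t * ι Q x * (ι Q t * ι Q s) =
          ι Q (QuadraticMap.polar Q t x • QuadraticMap.polar Q s s • t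
            - QuadraticMap.polar Q t x • Q s • t) * 0
          + ι Q s * ι Q (QuadraticMap.polar Q t x • t - Q t • x) * ι Q s := by
        rw [← ι_mul_ι_mul_ι]
        noncomm_ring
      have h6 : ι Q s * ι Q t * ι Q x * (ι Q t * ι Q s) = 0 := by
        have h7 : ι Q s * ι Q s = 0 := by rw [ι_sq_scalar, hs, map_zero]
        rw [h5, ht, zero_smul, sub_zero, mul_zero, zero_add, map_smul, mul_smul_comm, smul_mul_assoc,
          h2, neg_mul, mul_assoc, h7, mul_zero, neg_zero, smul_zero]
      refine ⟨x + (QuadraticMap.polar Q t x • s - QuadraticMap.polar Q s x • t), ?_⟩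
      rw [map_add, ← h4]
      simp only [map_add, reverse.map_mul, reverse_ι, reverse.map_one, map_one, map_mul,
        involute_ι, neg_mul_neg]
      rw [mul_add, add_mul, add_mul, add_mul, h6]
      simp only [one_mul, mul_one, add_zero]
      abel
  | one => intro x; exact ⟨x, by simp⟩
  | mul a b _ _ ha hb =>
    intro x
    obtain ⟨y, hy⟩ := hb x
    have : a * b * ι Q x * involute (reverse (a * b)) =
        a * (b * ι Q x * involute (reverse b)) * involute (reverse a) := by
      rw [reverse.map_mul, map_mul]
      simp only [mul_assoc]
    rw [this, ← hy]
    exact ha y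

/-- The main involution as a homomorphism on the units of the Clifford algebra. -/
abbrev involuteUnits (Q : QuadraticForm F V) : (CliffordAlgebra Q)ˣ →* (CliffordAlgebra Q)ˣ :=
  Units.map ((involute : CliffordAlgebra Q →ₐ[F] CliffordAlgebra Q) :
    CliffordAlgebra Q →* CliffordAlgebra Q)

/-- `x ↦ u x σ(u)⁻¹` on the Clifford algebra. -/
def twist {Q : QuadraticForm F V} (u : (CliffordAlgebra Q)ˣ) :
    CliffordAlgebra Q →ₗ[F] CliffordAlgebra Q :=
  LinearMap.mulLeftRight F
    ((u : CliffordAlgebra Q), (((involuteUnits Q u)⁻¹ : (CliffordAlgebra Q)ˣ) : CliffordAlgebra Q))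

theorem twist_apply {Q : QuadraticForm F V} (u : (CliffordAlgebra Q)ˣ) (z : CliffordAlgebra Q) :
    twist u z = (u : CliffordAlgebra Q) * z *
      (((involuteUnits Q u)⁻¹ : (CliffordAlgebra Q)ˣ) : CliffordAlgebra Q) := rfl

theorem twist_ι_mem {Q : QuadraticForm F V} (u : lipGroup Q) (x : V) :
    twist (u : (CliffordAlgebra Q)ˣ) (ι Q x) ∈ LinearMap.range (ι Q) := by
  obtain ⟨c, hc⟩ := exists_inv_eq_reverse (mem_lipGroup.1 u.2)
  have h : (((involuteUnits Q u)⁻¹ : (CliffordAlgebra Q)ˣ) : CliffordAlgebra Q) =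
      c • involute (reverse ((u : (CliffordAlgebra Q)ˣ) : CliffordAlgebra Q)) := by
    rw [← map_inv, Units.coe_map]
    change involute (((u : (CliffordAlgebra Q)ˣ)⁻¹ : (CliffordAlgebra Q)ˣ) : CliffordAlgebra Q) = _
    rw [hc, map_mul, AlgHom.commutes, Algebra.smul_def]
  rw [twist_apply, h, mul_smul_comm]
  exact Submodule.smul_mem _ _ (mul_ι_mul_involute_reverse_mem (mem_lipGroup.1 u.2) x)

/-- The linear map `V → V`, `x ↦ u x σ(u)⁻¹`, for `u` in the Lipschitz group. -/
noncomputable def xiLin {Q : QuadraticForm F V} (u : lipGroup Q) : V →ₗ[F] V :=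
  (LinearEquiv.ofInjective (ι Q) (ι_injective Q)).symm.toLinearMap ∘ₗ
    LinearMap.codRestrict (LinearMap.range (ι Q))
      (twist (u : (CliffordAlgebra Q)ˣ) ∘ₗ ι Q) (twist_ι_mem u)

theorem ι_xiLin {Q : QuadraticForm F V} (u : lipGroup Q) (x : V) :
    ι Q (xiLin u x) = twist (u : (CliffordAlgebra Q)ˣ) (ι Q x) := by
  have h := (LinearEquiv.ofInjective (ι Q) (ι_injective Q)).apply_symm_apply
    (⟨twist (u : (CliffordAlgebra Q)ˣ) (ι Q x), twist_ι_mem u x⟩ : LinearMap.range (ι Q))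
  exact congrArg Subtype.val h

theorem xiLin_one {Q : QuadraticForm F V} : xiLin (1 : lipGroup Q) = LinearMap.id := by
  ext x
  apply ι_injective Q
  rw [ι_xiLin, twist_apply]
  simp

theorem xiLin_mul {Q : QuadraticForm F V} (u v : lipGroup Q) :
    xiLin (u * v) = xiLin u ∘ₗ xiLin v := by
  ext x
  apply ι_injective Q
  rw [LinearMap.comp_apply, ι_xiLin, ι_xiLin, ι_xiLin]
  simp only [twist_apply, Subgroup.coe_mul, map_mul, mul_inv_rev, Units.val_mul, mul_assoc]

/-- The linear bijection `ξ_u : V → V`, `x ↦ u x σ(u)⁻¹`. -/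
noncomputable def xiEquiv {Q : QuadraticForm F V} (u : lipGroup Q) : V ≃ₗ[F] V :=
  LinearEquiv.ofLinearMap (xiLin u) (xiLin u⁻¹)
    (by rw [← xiLin_mul, mul_inv_cancel, xiLin_one])
    (by rw [← xiLin_mul, inv_mul_cancel, xiLin_one])

theorem xiEquiv_apply {Q : QuadraticForm F V} (u : lipGroup Q) (x : V) :
    xiEquiv u x = xiLin u x := rfl

theorem ι_mul_of_mem_perpSpace {Q : QuadraticForm F V} {x : V} (hx : x ∈ perpSpace Q)
    (p : CliffordAlgebra Q) : p * ι Q x = ι Q x * involute p := by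
  induction p using CliffordAlgebra.induction with
  | algebraMap r => rw [AlgHom.commutes, Algebra.commutes]
  | ι v =>
    rw [involute_ι, mul_neg, ι_mul_ι_comm, QuadraticMap.polar_comm, mem_perpSpace.1 hx v, map_zero,
      zero_sub]
  | mul a b ha hb => rw [map_mul, mul_assoc, hb, ← mul_assoc, ha, mul_assoc]
  | add a b ha hb => rw [map_add, add_mul, mul_add, ha, hb]

theorem xiEquiv_mem {Q : QuadraticForm F V} (u : lipGroup Q) :
    xiEquiv u ∈ weakOrthogonalGroup Q := by
  have hval : ∀ w : (CliffordAlgebra Q)ˣ,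
      ((involuteUnits Q w : (CliffordAlgebra Q)ˣ) : CliffordAlgebra Q) = involute (w : CliffordAlgebra Q) :=
    fun _ => rfl
  constructor
  · intro x
    apply (algebraMap F (CliffordAlgebra Q)).injective
    rw [xiEquiv_apply, ← ι_sq_scalar, ← ι_sq_scalar]
    have hneg : ι Q (xiLin u x) = -involute (ι Q (xiLin u x)) := by rw [involute_ι, neg_neg]
    have hinv : involute (twist (u : (CliffordAlgebra Q)ˣ) (ι Q x)) =
        -(((involuteUnits Q u : (CliffordAlgebra Q)ˣ) : CliffordAlgebra Q) * ι Q x *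
          (((u : (CliffordAlgebra Q)ˣ)⁻¹ : (CliffordAlgebra Q)ˣ) : CliffordAlgebra Q)) := by
      rw [twist_apply, map_mul, map_mul, involute_ι, ← map_inv, hval, hval, involute_involute]
      rw [mul_neg, neg_mul]
    have h2 : ι Q (xiLin u x) = ((involuteUnits Q u : (CliffordAlgebra Q)ˣ) : CliffordAlgebra Q) *
        ι Q x * (((u : (CliffordAlgebra Q)ˣ)⁻¹ : (CliffordAlgebra Q)ˣ) : CliffordAlgebra Q) := by
      rw [hneg, ι_xiLin, hinv, neg_neg]
    calc ι Q (xiLin u x) * ι Q (xiLin u x)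
        = twist (u : (CliffordAlgebra Q)ˣ) (ι Q x) *
          (((involuteUnits Q u : (CliffordAlgebra Q)ˣ) : CliffordAlgebra Q) *
          ι Q x * (((u : (CliffordAlgebra Q)ˣ)⁻¹ : (CliffordAlgebra Q)ˣ) : CliffordAlgebra Q)) := by
          rw [← h2, ← ι_xiLin]
      _ = ((u : (CliffordAlgebra Q)ˣ) : CliffordAlgebra Q) * (ι Q x * ι Q x) *
          (((u : (CliffordAlgebra Q)ˣ)⁻¹ : (CliffordAlgebra Q)ˣ) : CliffordAlgebra Q) := by
          rw [twist_apply]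
          simp only [mul_assoc, Units.inv_mul_cancel_left]
      _ = ι Q x * ι Q x := by
          rw [ι_sq_scalar, ← Algebra.commutes, mul_assoc, Units.mul_inv, mul_one]
  · intro x hx
    apply ι_injective Q
    rw [xiEquiv_apply, ι_xiLin, twist_apply, ι_mul_of_mem_perpSpace hx, ← hval, mul_assoc,
      Units.mul_inv, mul_one]

/-- The twisted adjoint representation `ξ : Lip^×(V, Q) → O'(V, Q)`, `p ↦ (x ↦ p x σ(p)⁻¹)`. -/
noncomputable def xi (Q : QuadraticForm F V) : lipGroup Q →* weakOrthogonalGroup Q where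
  toFun u := ⟨xiEquiv u, xiEquiv_mem u⟩
  map_one' := by
    apply Subtype.ext
    ext x
    change xiLin (1 : lipGroup Q) x = x
    rw [xiLin_one]; rfl
  map_mul' u v := by
    apply Subtype.ext
    ext x
    change xiLin (u * v) x = xiLin u (xiLin v x)
    rw [xiLin_mul]; rfl

theorem ι_xi {Q : QuadraticForm F V} (u : lipGroup Q) (x : V) :
    ι Q ((xi Q u : V ≃ₗ[F] V) x) = ((u : (CliffordAlgebra Q)ˣ) : CliffordAlgebra Q) * ι Q x *
      (((involuteUnits Q u)⁻¹ : (CliffordAlgebra Q)ˣ) : CliffordAlgebra Q) :=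
  ι_xiLin u x

/-! ### The group of points `𝒢(V, Q)` and the homomorphism `θ` -/

/-- `p ↦ F p` for units `p` of the Clifford algebra. The points `F p` are subspaces of the Clifford
algebra; their product as subspaces is `(F p) (F q) = F (p q)`. -/
noncomputable abbrev spanUnits (Q : QuadraticForm F V) :
    (CliffordAlgebra Q)ˣ →* (Submodule F (CliffordAlgebra Q))ˣ :=
  Units.map (Submodule.spanSingleton F).toMonoidHom

/-- `𝒢(V, Q) = {F p | p ∈ Lip^×(V, Q)}`, a group of points in the projective space on the Clifford
algebra with the product `(F p) (F q) = F (p q)` and the neutral element `F 1`. -/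
noncomputable def lipPoints (Q : QuadraticForm F V) :
    Subgroup (Submodule F (CliffordAlgebra Q))ˣ :=
  (lipGroup Q).map (spanUnits Q)

/-- A point of `𝒢(V, Q)` as a subspace of the Clifford algebra. -/
def lipPoints.toSubmodule {Q : QuadraticForm F V} (P : lipPoints Q) :
    Submodule F (CliffordAlgebra Q) :=
  ((P : (Submodule F (CliffordAlgebra Q))ˣ) : Submodule F (CliffordAlgebra Q))

/-- `𝒢_i(V, Q)`: the points of `𝒢(V, Q)` that are contained in the even part (`i = 0`) or in the
odd part (`i = 1`) of the Clifford algebra. -/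
def lipPointsGraded (Q : QuadraticForm F V) (i : ZMod 2) : Set (lipPoints Q) :=
  {P | lipPoints.toSubmodule P ≤ evenOdd Q i}

/-- The surjective homomorphism `Lip^×(V, Q) → 𝒢(V, Q)`, `p ↦ F p`. -/
noncomputable def toPoint (Q : QuadraticForm F V) : lipGroup Q →* lipPoints Q :=
  (spanUnits Q).subgroupMap (lipGroup Q)

theorem toPoint_surjective (Q : QuadraticForm F V) : Function.Surjective (toPoint Q) :=
  (spanUnits Q).subgroupMap_surjective (lipGroup Q)

theorem toSubmodule_toPoint {Q : QuadraticForm F V} (p : lipGroup Q) :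
    lipPoints.toSubmodule (toPoint Q p) =
      Submodule.span F {((p : (CliffordAlgebra Q)ˣ) : CliffordAlgebra Q)} := rfl

theorem toSubmodule_one {Q : QuadraticForm F V} :
    lipPoints.toSubmodule (1 : lipPoints Q) = Submodule.span F {(1 : CliffordAlgebra Q)} :=
  Submodule.one_eq_span

/-- The kernel of `p ↦ F p` is `F^×`, the group of non-zero scalars. -/
theorem mem_ker_toPoint {Q : QuadraticForm F V} {p : lipGroup Q} :
    p ∈ (toPoint Q).ker ↔ ∃ c : Fˣ, ((p : (CliffordAlgebra Q)ˣ) : CliffordAlgebra Q) =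
      algebraMap F (CliffordAlgebra Q) c := by
  have h : p ∈ (toPoint Q).ker ↔ (p : (CliffordAlgebra Q)ˣ) ∈ (spanUnits Q).ker := by
    rw [MonoidHom.mem_ker, MonoidHom.mem_ker, Subtype.ext_iff]; rfl
  rw [h, Submodule.ker_unitsMap_spanSingleton]
  constructor
  · rintro ⟨c, hc⟩
    exact ⟨c, by rw [← hc]; rfl⟩
  · rintro ⟨c, hc⟩
    exact ⟨c, Units.ext hc.symm⟩

theorem ker_toPoint_le (Q : QuadraticForm F V) :
    (toPoint Q).ker ≤ ((QuotientGroup.mk' (weakScalars Q)).comp (xi Q)).ker := by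
  intro p hp
  obtain ⟨c, hc⟩ := mem_ker_toPoint.1 hp
  have h : xi Q p = 1 := by
    apply Subtype.ext
    ext x
    apply ι_injective Q
    rw [ι_xi]
    have h1 : involuteUnits Q p = p := by
      apply Units.ext
      change involute ((p : (CliffordAlgebra Q)ˣ) : CliffordAlgebra Q) = _
      rw [hc, AlgHom.commutes]
    rw [h1, hc, Algebra.commutes, mul_assoc, ← hc, Units.mul_inv, mul_one]
    rfl
  rw [MonoidHom.mem_ker, MonoidHom.comp_apply, h, map_one]

/-- `θ : 𝒢(V, Q) → PO'(V, Q)`, `F p ↦ I'(V, Q) ∘ ξ_p`. -/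
noncomputable def theta (Q : QuadraticForm F V) : lipPoints Q →* ProjWeakOrthogonalGroup Q :=
  (toPoint Q).liftOfSurjective (toPoint_surjective Q)
    ⟨(QuotientGroup.mk' (weakScalars Q)).comp (xi Q), ker_toPoint_le Q⟩

theorem theta_toPoint {Q : QuadraticForm F V} (p : lipGroup Q) :
    theta Q (toPoint Q p) = (xi Q p : ProjWeakOrthogonalGroup Q) :=
  (toPoint Q).liftOfRightInverse_comp_apply _ _ _ p

/-- The product `e_0 e_1 ⋯ e_n` in the Clifford algebra of a finite sequence of vectors. -/
def vecProd (Q : QuadraticForm F V) {m : ℕ} (e : Fin m → V) : CliffordAlgebra Q :=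
  (List.ofFn fun j => ι Q (e j)).prod

end ProjMetric

namespace ProjMetric

open CliffordAlgebra

variable {F V : Type*} [Field F] [AddCommGroup V] [Module F V]

/-! ### Elements of the Clifford algebra that are killed by all contractions -/

/-! Everything rests on two facts about `ξ` when `V^⊥ = 0`.

Its kernel is `F^×`. The condition `ξ_p = id` reads `p x = x σ(p)`, which says that the graded
commutator of `σ(p)` with every vector vanishes. That commutator is the contraction by `B(x, ·)`,
and nondegeneracy turns every linear form into some `B(x, ·)`. An element killed by all contractions
is a scalar (`mem_range_algebraMap_of_contractLeft_eq_zero`).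

It is surjective. An isometry `φ ≠ id` agrees, on all its fixed vectors and on one vector that it
moves, with a reflection or with some `ξ_{1 + st}` (`exists_lipGroup_agree`). Dividing by that map
enlarges the fixed space.

Hence `ker θ` consists of `F1` and the one point over `-id`. The two coincide if `-id = id`, that
is, in characteristic 2 or for `V = 0`. Otherwise the second point is `Fe`, because `e` acts as the
product of the reflections along an orthogonal basis. Each point is either even or odd and not both,
so `θ(𝒢_0)` is all of `PO'` once the kernel has an odd point (`theta_image_eq_univ`). It is proper
if the kernel is even and a nonsingular vector exists (`theta_image_ne_univ`). -/

theorem map_id_sub_smulRight_eq (d : Module.Dual F V) (v : V) (q : ExteriorAlgebra F V) :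
    ExteriorAlgebra.map (LinearMap.id - d.smulRight v) q =
      q - ExteriorAlgebra.ι F v * contractLeft d q := by
  -- The identity is exact, not merely first order in `v`, because the quadratic term contains `v ∧
  -- v = 0`.
  induction q using CliffordAlgebra.left_induction with
  | algebraMap r => rw [AlgHom.commutes, contractLeft_algebraMap, mul_zero, sub_zero]
  | add x y hx hy => rw [map_add, map_add, hx, hy]; noncomm_ring
  | ι_mul x m hx =>
    have h1 : ExteriorAlgebra.ι F v * ExteriorAlgebra.ι F v = 0 :=
      ExteriorAlgebra.ι_sq_zero v
    have h2 : ExteriorAlgebra.ι F m * ExteriorAlgebra.ι F v =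
        -(ExteriorAlgebra.ι F v * ExteriorAlgebra.ι F m) :=
      eq_neg_of_add_eq_zero_left (ExteriorAlgebra.ι_add_mul_swap m v)
    have h3 : ExteriorAlgebra.map (LinearMap.id - d.smulRight v)
        (ExteriorAlgebra.ι F m) = ExteriorAlgebra.ι F m - d m • ExteriorAlgebra.ι F v := by
      rw [ExteriorAlgebra.map_apply_ι]
      simp
    rw [contractLeft_ι_mul, map_mul, hx]
    change ExteriorAlgebra.map _ (ExteriorAlgebra.ι F m) * _ = ExteriorAlgebra.ι F m * x -
      ExteriorAlgebra.ι F v * (d m • x - ExteriorAlgebra.ι F m * _)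
    rw [h3, sub_mul, mul_sub, mul_sub, mul_sub, smul_mul_assoc, smul_mul_assoc, ← mul_assoc,
      ← mul_assoc, ← mul_assoc, h1, h2, mul_smul_comm,
      zero_mul, smul_zero, sub_zero]
    noncomm_ring

/-- The zero endomorphism kills every product that has a vector as a factor, so only the degree-zero
part survives. -/
theorem map_zero_mem_range_algebraMap (q : ExteriorAlgebra F V) :
    ExteriorAlgebra.map (0 : V →ₗ[F] V) q ∈ Set.range (algebraMap F (ExteriorAlgebra F V)) := by
  induction q using CliffordAlgebra.left_induction with
  | algebraMap r => exact ⟨r, (AlgHom.commutes _ r).symm⟩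
  | add x y hx hy =>
    obtain ⟨a, ha⟩ := hx
    obtain ⟨b, hb⟩ := hy
    exact ⟨a + b, by rw [map_add, map_add, ha, hb]⟩
  | ι_mul x m hx =>
    refine ⟨0, ?_⟩
    rw [map_mul]
    change _ = ExteriorAlgebra.map 0 (ExteriorAlgebra.ι F m) * _
    rw [ExteriorAlgebra.map_apply_ι, LinearMap.zero_apply, map_zero, map_zero, zero_mul]

/-- `changeForm` commutes with contractions, so the question moves to the exterior algebra. There an
element killed by all contractions is fixed by each map induced by `id - d ⊗ v`. The zero
endomorphism is a composite of such maps, and what it fixes is scalar. -/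
theorem mem_range_algebraMap_of_contractLeft_eq_zero [FiniteDimensional F V]
    (Q : QuadraticForm F V) {p : CliffordAlgebra Q}
    (hp : ∀ d : Module.Dual F V, contractLeft d p = 0) :
    p ∈ Set.range (algebraMap F (CliffordAlgebra Q)) := by
  obtain ⟨B, h⟩ := exists_changeForm_zero Q
  set q : ExteriorAlgebra F V := changeForm h p with hqdef
  have hq : ∀ d : Module.Dual F V, contractLeft d q = 0 := fun d => by
    rw [hqdef, ← changeForm_contractLeft, hp, map_zero]
  let b := Module.finBasis F V
  have key : ∀ S : Finset (Fin (Module.finrank F V)),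
      ExteriorAlgebra.map (LinearMap.id - ∑ i ∈ S, (b.coord i).smulRight (b i)) q = q := by
    intro S
    induction S using Finset.induction_on with
    | empty =>
      rw [Finset.sum_empty, sub_zero, ExteriorAlgebra.map_id, AlgHom.id_apply]
    | insert i S hi ih =>
      -- The cross term of the composite vanishes because the coordinates indexed by `S` are zero on
      -- `b i`.
      have hcomp : (LinearMap.id - ∑ j ∈ insert i S, (b.coord j).smulRight (b j) : V →ₗ[F] V) =
          (LinearMap.id - ∑ j ∈ S, (b.coord j).smulRight (b j)) ∘ₗ
            (LinearMap.id - (b.coord i).smulRight (b i)) := by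
        have h0 : (∑ j ∈ S, (b.coord j).smulRight (b j)) (b i) = 0 := by
          rw [LinearMap.sum_apply]
          refine Finset.sum_eq_zero fun j hj => ?_
          have hij : i ≠ j := fun hij => hi (hij ▸ hj)
          simp [Finsupp.single_eq_of_ne hij.symm]
        ext x
        rw [Finset.sum_insert hi, LinearMap.comp_apply]
        simp only [LinearMap.sub_apply, LinearMap.add_apply, LinearMap.id_apply,
          LinearMap.smulRight_apply, map_sub, map_smul, h0]
        rw [sub_zero]
        abel
      rw [hcomp, ← ExteriorAlgebra.map_comp_map, AlgHom.comp_apply, map_id_sub_smulRight_eq, hq,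
        mul_zero, sub_zero, ih]
  have hsum : (LinearMap.id - ∑ i, (b.coord i).smulRight (b i) : V →ₗ[F] V) = 0 := by
    ext x
    simp only [LinearMap.sub_apply, LinearMap.sum_apply, LinearMap.smulRight_apply,
      LinearMap.id_apply, Module.Basis.coord_apply, b.sum_repr, sub_self, LinearMap.zero_apply]
  have hu := key Finset.univ
  rw [hsum] at hu
  obtain ⟨a, ha⟩ := map_zero_mem_range_algebraMap q
  refine ⟨a, (changeFormEquiv h).injective ?_⟩
  change changeForm h _ = changeForm h p
  rw [changeForm_algebraMap, ← hqdef, ← hu, ← ha]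

/-- Contraction by `B(x, ·)` is the graded commutator with `x`. -/
theorem contractLeft_polarForm (Q : QuadraticForm F V) (x : V) (q : CliffordAlgebra Q) :
    contractLeft (polarForm Q x) q = ι Q x * q - involute q * ι Q x := by
  induction q using CliffordAlgebra.left_induction with
  | algebraMap r => rw [contractLeft_algebraMap, AlgHom.commutes, Algebra.commutes, sub_self]
  | add a b ha hb => rw [map_add, map_add, ha, hb]; noncomm_ring
  | ι_mul a m ha =>
    have h : (polarForm Q x m) • a = (ι Q x * ι Q m + ι Q m * ι Q x) * a := by
      rw [ι_mul_ι_add_swap, Algebra.smul_def]; rfl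
    rw [contractLeft_ι_mul, ha, map_mul, involute_ι, h]
    noncomm_ring

theorem polarForm_comm (Q : QuadraticForm F V) (x y : V) : polarForm Q x y = polarForm Q y x :=
  QuadraticMap.polar_comm Q x y

theorem apply_add_eq (Q : QuadraticForm F V) (x y : V) :
    Q (x + y) = Q x + Q y + polarForm Q x y := QuadraticMap.map_add Q x y

theorem polarForm_self (Q : QuadraticForm F V) (x : V) : polarForm Q x x = 2 * Q x := by
  simp

section Nondegenerate

variable {Q : QuadraticForm F V}

theorem exists_polarForm_ne_zero (hB : perpSpace Q = ⊥) {x : V} (hx : x ≠ 0) :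
    ∃ y, polarForm Q x y ≠ 0 := by
  by_contra! h
  have : x ∈ perpSpace Q := mem_perpSpace.2 h
  rw [hB] at this
  exact hx this

/-- The only elements of the Clifford algebra that commute with all vectors up to the main
involution are the scalars. -/
theorem mem_range_algebraMap_of_mul_ι_eq [FiniteDimensional F V] (hB : perpSpace Q = ⊥)
    {p : CliffordAlgebra Q} (hp : ∀ x, p * ι Q x = ι Q x * involute p) :
    p ∈ Set.range (algebraMap F (CliffordAlgebra Q)) := by
  -- In finite dimension, `V^⊥ = 0` makes every linear form equal to some `B(x, ·)`.
  have hinj : Function.Injective (polarForm Q) := LinearMap.ker_eq_bot.1 hB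
  have hsurj : Function.Surjective (polarForm Q) :=
    (LinearMap.injective_iff_surjective_of_finrank_eq_finrank
      (Subspace.dual_finrank_eq (K := F) (V := V)).symm).1 hinj
  -- For `σ(p)` the graded commutator is `x σ(p) - p x`, which is zero by hypothesis.
  obtain ⟨c, hc⟩ := mem_range_algebraMap_of_contractLeft_eq_zero Q (p := involute p) fun d => by
    obtain ⟨x, rfl⟩ := hsurj d
    rw [contractLeft_polarForm, involute_involute, hp, sub_self]
  refine ⟨c, ?_⟩
  rw [← involute_involute p, ← hc, AlgHom.commutes]

end Nondegenerate

/-! ### Reflections and the isometries `ξ_{1 + st}` -/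

section Generators

variable {Q : QuadraticForm F V}

/-- Multiplying by `σ(u)` removes the inverse from the definition of `ξ_u`; the generators are
checked in this form. -/
theorem xi_apply_eq_of_mul_ι_eq (u : lipGroup Q) {x y : V}
    (h : ((u : (CliffordAlgebra Q)ˣ) : CliffordAlgebra Q) * ι Q x =
      ι Q y * involute ((u : (CliffordAlgebra Q)ˣ) : CliffordAlgebra Q)) :
    (xi Q u : V ≃ₗ[F] V) x = y := by
  apply ι_injective Q
  rw [ι_xi, h]
  exact Units.mul_inv_cancel_right _ (involuteUnits Q u)

theorem mul_ι_eq_of_xi_apply_eq (u : lipGroup Q) {x y : V} (h : (xi Q u : V ≃ₗ[F] V) x = y) :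
    ((u : (CliffordAlgebra Q)ˣ) : CliffordAlgebra Q) * ι Q x =
      ι Q y * involute ((u : (CliffordAlgebra Q)ˣ) : CliffordAlgebra Q) := by
  rw [← h, ι_xi]
  exact (Units.inv_mul_cancel_right _ (involuteUnits Q u)).symm

theorem exists_lipGroup_of_isUnit {p : CliffordAlgebra Q} (hp : IsUnit p) (h : p ∈ lipMonoid Q) :
    ∃ u : lipGroup Q, ((u : (CliffordAlgebra Q)ˣ) : CliffordAlgebra Q) = p := by
  obtain ⟨u, rfl⟩ := hp
  exact ⟨⟨u, mem_lipGroup.2 h⟩, rfl⟩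

theorem ι_mem_lipMonoid (v : V) : ι Q v ∈ lipMonoid Q :=
  Submonoid.subset_closure (Or.inl (Or.inr ⟨v, rfl⟩))

/-- Since `v² = Q(v)`, the vector is a unit, and `v x = B(v, x) - x v` gives the formula. The sign
in `σ(v) = -v` makes `ξ_v` the reflection itself and not its negative. -/
theorem exists_lipGroup_reflection {v : V} (hv : Q v ≠ 0) :
    ∃ u : lipGroup Q, ((u : (CliffordAlgebra Q)ˣ) : CliffordAlgebra Q) = ι Q v ∧
      ∀ x, (xi Q u : V ≃ₗ[F] V) x = x - (polarForm Q v x / Q v) • v := by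
  obtain ⟨u, hu⟩ := exists_lipGroup_of_isUnit (isUnit_ι_of_isUnit (Q := Q) hv.isUnit)
    (ι_mem_lipMonoid v)
  refine ⟨u, hu, fun x => xi_apply_eq_of_mul_ι_eq u ?_⟩
  rw [hu, involute_ι, map_sub, map_smul, sub_mul, smul_mul_assoc, mul_neg, mul_neg, ι_sq_scalar,
    ι_mul_ι_comm, smul_neg, Algebra.smul_def, ← map_mul (algebraMap F _), div_mul_cancel₀ _ hv]
  change algebraMap F _ (polarForm Q v x) - _ = _
  abel

/-- As `(st)² = 0`, the element `1 + st` is a unit, and it is fixed by `σ`. The commutator of `st`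
with `x` is the vector `z = B(t, x) s - B(s, x) t`. Since `s` and `t` both annihilate `st`, also `z
st = 0`, so `(1 + st) x = (x + z)(1 + st)`. -/
theorem exists_lipGroup_transvection {s t : V} (hs : Q s = 0) (ht : Q t = 0)
    (hst : polarForm Q s t = 0) :
    ∃ u : lipGroup Q, ∀ x, (xi Q u : V ≃ₗ[F] V) x =
      x + (polarForm Q t x • s - polarForm Q s x • t) := by
  have hss : ι Q s * ι Q s = 0 := by rw [ι_sq_scalar, hs, map_zero]
  have htt : ι Q t * ι Q t = 0 := by rw [ι_sq_scalar, ht, map_zero]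
  have hts : ι Q s * ι Q t = -(ι Q t * ι Q s) := by
    refine eq_neg_of_add_eq_zero_left ?_
    rw [ι_mul_ι_add_swap]
    exact (congrArg _ hst).trans (map_zero _)
  have hsq : ι Q s * ι Q t * (ι Q s * ι Q t) = 0 := by
    rw [hts, neg_mul_neg, mul_assoc, ← mul_assoc (ι Q s), hts, neg_mul, mul_assoc, hss]
    simp
  have hunit : IsUnit (1 + ι Q s * ι Q t) :=
    IsNilpotent.isUnit_one_add ⟨2, by rw [pow_two, hsq]⟩
  obtain ⟨u, hu⟩ := exists_lipGroup_of_isUnit hunit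
    (Submonoid.subset_closure (Or.inr ⟨s, t, hs, ht, hst, rfl⟩))
  refine ⟨u, fun x => xi_apply_eq_of_mul_ι_eq u ?_⟩
  have hB : ∀ a b : V, algebraMap F (CliffordAlgebra Q) (polarForm Q a b) =
      ι Q a * ι Q b + ι Q b * ι Q a := fun a b => (ι_mul_ι_add_swap a b).symm
  have h1 : ι Q (polarForm Q t x • s - polarForm Q s x • t) =
      ι Q s * ι Q t * ι Q x - ι Q x * (ι Q s * ι Q t) := by
    rw [map_sub, map_smul, map_smul, Algebra.smul_def, Algebra.smul_def, Algebra.commutes, hB, hB,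
      mul_add, add_mul]
    have : ι Q x * (ι Q s * ι Q t) = ι Q x * ι Q s * ι Q t := (mul_assoc _ _ _).symm
    rw [this]
    noncomm_ring
  have h2 : ι Q (polarForm Q t x • s - polarForm Q s x • t) * (ι Q s * ι Q t) = 0 := by
    have e1 : ι Q s * (ι Q s * ι Q t) = 0 := by rw [← mul_assoc, hss, zero_mul]
    have e2 : ι Q t * (ι Q s * ι Q t) = 0 := by
      rw [hts, mul_neg, ← mul_assoc, htt, zero_mul, neg_zero]
    rw [map_sub, map_smul, map_smul, sub_mul, smul_mul_assoc, smul_mul_assoc, e1, e2]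
    simp
  have h3 : involute (1 + ι Q s * ι Q t) = 1 + ι Q s * ι Q t := by
    simp
  rw [hu, h3, map_add, add_mul _ _ (1 + _), mul_add (ι Q (_ - _)), h2, h1]
  noncomm_ring

end Generators

/-! ### Surjectivity of the twisted adjoint representation -/

section Surjective

variable {Q : QuadraticForm F V}

/-- Expand `Q` at `φ x = (φ x - x) + x`. This value is what makes the reflection along `φ x - x`
carry `x` to `φ x`. -/
theorem apply_sub_self_eq_neg {φ : V ≃ₗ[F] V} (hφ : ∀ x, Q (φ x) = Q x) (x : V) :
    Q (φ x - x) = -polarForm Q (φ x - x) x := by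
  have h := apply_add_eq Q (φ x - x) x
  rw [sub_add_cancel, hφ] at h
  linear_combination -h

theorem polarForm_apply_apply {φ : V ≃ₗ[F] V} (hφ : ∀ x, Q (φ x) = Q x) (x y : V) :
    polarForm Q (φ x) (φ y) = polarForm Q x y := by
  have h := apply_add_eq Q (φ x) (φ y)
  rw [← map_add, hφ, hφ, hφ, apply_add_eq Q x y] at h
  linear_combination -h

/-- `B(φ x, y) = B(φ x, φ y) = B(x, y)`. Consequently maps `ξ_u` built from differences `φ x - x`
leave the fixed vectors of `φ` fixed. -/
theorem polarForm_apply_sub_self_of_fixed {φ : V ≃ₗ[F] V} (hφ : ∀ x, Q (φ x) = Q x) (x : V) {y : V}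
    (hy : φ y = y) : polarForm Q (φ x - x) y = 0 := by
  have h := polarForm_apply_apply hφ x y
  rw [hy] at h
  rw [map_sub, LinearMap.sub_apply, h, sub_self]

/-- Every non-trivial isometry agrees with some `ξ_u` on all its fixed vectors and on a vector
that it moves. -/
theorem exists_lipGroup_agree (hB : perpSpace Q = ⊥) {φ : V ≃ₗ[F] V} (hφ : ∀ x, Q (φ x) = Q x)
    (hne : ∃ x, φ x ≠ x) :
    ∃ u : lipGroup Q, (∀ y, φ y = y → (xi Q u : V ≃ₗ[F] V) y = y) ∧
      ∃ x, φ x ≠ x ∧ (xi Q u : V ≃ₗ[F] V) x = φ x := by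
  by_cases hsing : ∀ x, Q (φ x - x) = 0
  -- Here `φ - id` has a totally singular image, so no reflection along a difference is available.
  -- The form `B(φ x - x, y)` is then alternating, hence skew.
  · obtain ⟨x, hx⟩ := hne
    obtain ⟨y, hy⟩ := exists_polarForm_ne_zero hB (sub_ne_zero.2 hx)
    have hst : polarForm Q (φ x - x) (φ y - y) = 0 := by
      have h := apply_add_eq Q (φ x - x) (φ y - y)
      have h' := hsing (x + y)
      rw [map_add, add_sub_add_comm, h, hsing, hsing, zero_add, zero_add] at h'
      exact h'
    have halt : ∀ z, polarForm Q (φ z - z) z = 0 := fun z => by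
      have h := apply_sub_self_eq_neg hφ z
      rw [hsing] at h
      exact neg_eq_zero.1 h.symm
    have hskew : polarForm Q (φ y - y) x = -polarForm Q (φ x - x) y := by
      have h := halt (x + y)
      rw [map_add φ, add_sub_add_comm, map_add, map_add, LinearMap.add_apply, LinearMap.add_apply,
        halt, halt, zero_add, add_zero] at h
      exact eq_neg_of_add_eq_zero_left h
    set a := polarForm Q (φ x - x) y with ha
    -- With this `s` and `t`, `B(s, x) = 0` and `B(t, x) = -a`. The factor `-a⁻¹` therefore makes
    -- the displacement of `x` exactly `φ x - x`.
    obtain ⟨u, hu⟩ := exists_lipGroup_transvection (Q := Q) (s := -a⁻¹ • (φ x - x))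
      (t := φ y - y) (by rw [QuadraticMap.map_smul, hsing, smul_zero]) (hsing y)
      (by rw [map_smul, LinearMap.smul_apply, hst, smul_zero])
    refine ⟨u, fun z hz => ?_, x, hx, ?_⟩
    · rw [hu, map_smul, LinearMap.smul_apply, polarForm_apply_sub_self_of_fixed hφ x hz,
        polarForm_apply_sub_self_of_fixed hφ y hz]
      simp
    · rw [hu, map_smul, LinearMap.smul_apply, halt, hskew, smul_zero, zero_smul, sub_zero, smul_smul,
        neg_mul_neg, mul_inv_cancel₀ hy, one_smul, add_sub_cancel]
  · push Not at hsing
    -- Some difference is nonsingular, and the reflection along it does the job.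
    obtain ⟨x, hx⟩ := hsing
    obtain ⟨u, -, hu⟩ := exists_lipGroup_reflection hx
    refine ⟨u, fun y hy => ?_, x, fun h => hx (by rw [h, sub_self, QuadraticMap.map_zero]), ?_⟩
    · rw [hu, polarForm_apply_sub_self_of_fixed hφ x hy, zero_div, zero_smul, sub_zero]
    · have h : polarForm Q (φ x - x) x = -Q (φ x - x) := by
        rw [apply_sub_self_eq_neg hφ, neg_neg]
      rw [hu, h, neg_div, div_self hx, neg_smul, one_smul, sub_neg_eq_add, add_sub_cancel]

/-- Strong induction on the codimension of the fixed space: `ξ_u⁻¹ φ` fixes everything that `φ`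
fixes and one further vector. -/
theorem xi_surjective [FiniteDimensional F V] (hB : perpSpace Q = ⊥) :
    Function.Surjective (xi Q) := by
  suffices H : ∀ (n : ℕ) (φ : weakOrthogonalGroup Q), Module.finrank F V -
      Module.finrank F (LinearMap.ker ((φ : V ≃ₗ[F] V).toLinearMap - LinearMap.id)) = n →
      φ ∈ (xi Q).range from fun φ => MonoidHom.mem_range.1 (H _ φ rfl)
  intro n
  induction n using Nat.strong_induction_on with
  | _ n ih =>
    intro φ hn
    by_cases hne : ∃ x, (φ : V ≃ₗ[F] V) x ≠ x
    · obtain ⟨u, hfix, x, hx, hux⟩ := exists_lipGroup_agree hB φ.2.1 hne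
      have happ : ∀ y, (((xi Q u)⁻¹ * φ : weakOrthogonalGroup Q) : V ≃ₗ[F] V) y =
          (xi Q u : V ≃ₗ[F] V).symm ((φ : V ≃ₗ[F] V) y) := fun _ => rfl
      have hmem : ∀ (ψ : weakOrthogonalGroup Q) (y : V),
          y ∈ LinearMap.ker ((ψ : V ≃ₗ[F] V).toLinearMap - LinearMap.id) ↔
            (ψ : V ≃ₗ[F] V) y = y := fun ψ y => by
        rw [LinearMap.mem_ker, LinearMap.sub_apply, sub_eq_zero]; rfl
      have hlt : LinearMap.ker ((φ : V ≃ₗ[F] V).toLinearMap - LinearMap.id) <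
          LinearMap.ker ((((xi Q u)⁻¹ * φ : weakOrthogonalGroup Q) : V ≃ₗ[F] V).toLinearMap -
            LinearMap.id) := by
        refine SetLike.lt_iff_le_and_exists.2 ⟨fun y hy => ?_, x, ?_, ?_⟩
        · rw [hmem] at hy ⊢
          rw [happ, hy, LinearEquiv.symm_apply_eq, hfix y hy]
        · rw [hmem, happ, ← hux, LinearEquiv.symm_apply_apply]
        · rwa [hmem]
      have h1 := Submodule.finrank_lt_finrank_of_lt hlt
      have h2 := Submodule.finrank_le (LinearMap.ker
        ((((xi Q u)⁻¹ * φ : weakOrthogonalGroup Q) : V ≃ₗ[F] V).toLinearMap - LinearMap.id))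
      have h3 := ih _ (by omega) ((xi Q u)⁻¹ * φ) rfl
      have h4 := mul_mem (MonoidHom.mem_range.2 ⟨u, rfl⟩ : xi Q u ∈ (xi Q).range) h3
      rwa [mul_inv_cancel_left] at h4
    · push Not at hne
      have : φ = 1 := Subtype.ext (LinearEquiv.ext hne)
      rw [this]
      exact one_mem _

theorem theta_surjective [FiniteDimensional F V] (hB : perpSpace Q = ⊥) :
    Function.Surjective (theta Q) := by
  intro g
  obtain ⟨φ, rfl⟩ := QuotientGroup.mk_surjective g
  obtain ⟨u, rfl⟩ := xi_surjective hB φ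
  exact ⟨toPoint Q u, theta_toPoint u⟩

end Surjective

/-! ### The grading of the points -/

section Grading

variable {Q : QuadraticForm F V}

theorem toPoint_mem_lipPointsGraded {u : lipGroup Q} {i : ZMod 2} :
    toPoint Q u ∈ lipPointsGraded Q i ↔
      ((u : (CliffordAlgebra Q)ˣ) : CliffordAlgebra Q) ∈ evenOdd Q i := by
  change lipPoints.toSubmodule _ ≤ _ ↔ _
  rw [toSubmodule_toPoint, Submodule.span_singleton_le_iff_mem]

theorem one_mem_lipPointsGraded : (1 : lipPoints Q) ∈ lipPointsGraded Q 0 := by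
  rw [← map_one (toPoint Q), toPoint_mem_lipPointsGraded]
  exact one_le_evenOdd_zero Q (Submodule.one_le.1 le_rfl)

theorem mul_mem_lipPointsGraded {P R : lipPoints Q} {i j : ZMod 2}
    (hP : P ∈ lipPointsGraded Q i) (hR : R ∈ lipPointsGraded Q j) :
    P * R ∈ lipPointsGraded Q (i + j) := by
  obtain ⟨p, rfl⟩ := toPoint_surjective Q P
  obtain ⟨r, rfl⟩ := toPoint_surjective Q R
  rw [← map_mul]
  rw [toPoint_mem_lipPointsGraded] at *
  exact evenOdd_mul_le Q i j (Submodule.mul_mem_mul hP hR)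

theorem not_mem_lipPointsGraded_zero_and_one {P : lipPoints Q} (h0 : P ∈ lipPointsGraded Q 0)
    (h1 : P ∈ lipPointsGraded Q 1) : False := by
  obtain ⟨p, rfl⟩ := toPoint_surjective Q P
  rw [toPoint_mem_lipPointsGraded] at h0 h1
  exact (p : (CliffordAlgebra Q)ˣ).ne_zero
    (Submodule.disjoint_def.1 (evenOdd_isCompl Q).disjoint _ h0 h1)

/-- Every generator is homogeneous, and degrees modulo 2 add under multiplication. -/
theorem exists_mem_evenOdd_of_mem_lipMonoid {p : CliffordAlgebra Q} (hp : p ∈ lipMonoid Q) :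
    ∃ i, p ∈ evenOdd Q i := by
  have halg : ∀ c : F, algebraMap F (CliffordAlgebra Q) c ∈ evenOdd Q 0 := fun c =>
    one_le_evenOdd_zero Q (Submodule.mem_one.2 ⟨c, rfl⟩)
  induction hp using Submonoid.closure_induction with
  | mem m hm =>
    rcases hm with (⟨c, rfl⟩ | ⟨v, rfl⟩) | ⟨s, t, -, -, -, rfl⟩
    · exact ⟨0, halg c⟩
    · exact ⟨1, ι_mem_evenOdd_one Q v⟩
    · exact ⟨0, add_mem (one_le_evenOdd_zero Q (Submodule.one_le.1 le_rfl))
        (ι_mul_ι_mem_evenOdd_zero Q s t)⟩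
  | one => exact ⟨0, one_le_evenOdd_zero Q (Submodule.one_le.1 le_rfl)⟩
  | mul a b _ _ ha hb =>
    obtain ⟨i, hi⟩ := ha
    obtain ⟨j, hj⟩ := hb
    exact ⟨i + j, evenOdd_mul_le Q i j (Submodule.mul_mem_mul hi hj)⟩

theorem exists_mem_lipPointsGraded (P : lipPoints Q) : ∃ i, P ∈ lipPointsGraded Q i := by
  obtain ⟨p, rfl⟩ := toPoint_surjective Q P
  obtain ⟨i, hi⟩ := exists_mem_evenOdd_of_mem_lipMonoid (mem_lipGroup.1 p.2)
  exact ⟨i, toPoint_mem_lipPointsGraded.2 hi⟩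

/-- The class of the reflection along `v` is missed: an even point with the same image would differ
from `Fv` by an even kernel point, forcing the odd point `Fv` to be even. -/
theorem theta_image_ne_univ (hker : ∀ P ∈ (theta Q).ker, P ∈ lipPointsGraded Q 0)
    {v : V} (hv : Q v ≠ 0) : theta Q '' lipPointsGraded Q 0 ≠ Set.univ := by
  intro h
  obtain ⟨u, hu, -⟩ := exists_lipGroup_reflection hv
  obtain ⟨P, hP, hPu⟩ := h.ge (Set.mem_univ (theta Q (toPoint Q u)))
  have hR := hker (P⁻¹ * toPoint Q u) (by
    rw [MonoidHom.mem_ker, map_mul, map_inv, hPu, inv_mul_cancel])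
  have h0 := mul_mem_lipPointsGraded hP hR
  rw [mul_inv_cancel_left, add_zero] at h0
  refine not_mem_lipPointsGraded_zero_and_one h0 (toPoint_mem_lipPointsGraded.2 ?_)
  rw [hu]
  exact ι_mem_evenOdd_one Q v

/-- Multiplication by an odd kernel point turns an odd preimage into an even one. -/
theorem theta_image_eq_univ (hsurj : Function.Surjective (theta Q)) {R : lipPoints Q}
    (hR : R ∈ (theta Q).ker) (hR1 : R ∈ lipPointsGraded Q 1) :
    theta Q '' lipPointsGraded Q 0 = Set.univ := by
  refine Set.eq_univ_of_forall fun g => ?_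
  obtain ⟨P, rfl⟩ := hsurj g
  obtain ⟨i, hi⟩ := exists_mem_lipPointsGraded P
  have h01 : ∀ j : ZMod 2, j = 0 ∨ j = 1 := by decide
  rcases h01 i with rfl | rfl
  · exact ⟨P, hi, rfl⟩
  · have hPR := mul_mem_lipPointsGraded hi hR1
    rw [show (1 : ZMod 2) + 1 = 0 by decide] at hPR
    exact ⟨P * R, hPR, by
      rw [map_mul, MonoidHom.mem_ker.1 hR, mul_one]⟩

end Grading

/-! ### The kernel of `θ` -/

section Kernel

variable {Q : QuadraticForm F V}

theorem toPoint_eq_one_of_xi_eq_one [FiniteDimensional F V] (hB : perpSpace Q = ⊥)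
    {u : lipGroup Q} (hu : xi Q u = 1) : toPoint Q u = 1 := by
  obtain ⟨c, hc⟩ := mem_range_algebraMap_of_mul_ι_eq hB
    (p := ((u : (CliffordAlgebra Q)ˣ) : CliffordAlgebra Q))
    fun x => mul_ι_eq_of_xi_apply_eq u (by rw [hu]; rfl)
  have h0 : c ≠ 0 := by
    rintro rfl
    rw [map_zero] at hc
    exact (u : (CliffordAlgebra Q)ˣ).ne_zero hc.symm
  exact mem_ker_toPoint.2 ⟨Units.mk0 c h0, hc.symm⟩

theorem toPoint_mem_ker_theta {u : lipGroup Q} :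
    toPoint Q u ∈ (theta Q).ker ↔ xi Q u ∈ weakScalars Q := by
  rw [MonoidHom.mem_ker, theta_toPoint, QuotientGroup.eq_one_iff]

/-- The hypothesis `hneg` covers both characteristic 2 and the zero space. -/
theorem ker_theta_eq_singleton [FiniteDimensional F V] (hB : perpSpace Q = ⊥)
    (hneg : ∀ x : V, -x = x) : ((theta Q).ker : Set (lipPoints Q)) = {1} := by
  refine Set.Subset.antisymm (fun P hP => ?_) (Set.singleton_subset_iff.2 (one_mem _))
  obtain ⟨u, rfl⟩ := toPoint_surjective Q P
  refine toPoint_eq_one_of_xi_eq_one hB (Subtype.ext ?_)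
  rcases mem_weakScalars.1 (toPoint_mem_ker_theta.1 hP) with h | h
  · exact h
  · rw [h]
    exact LinearEquiv.ext hneg

/-- If `ξ_u = -id`, then `u w⁻¹` lies in the kernel of `ξ`, so `u` and `w` span the same point. -/
theorem ker_theta_eq_pair [FiniteDimensional F V] (hB : perpSpace Q = ⊥) {w : lipGroup Q}
    (hw : (xi Q w : V ≃ₗ[F] V) = LinearEquiv.neg F) :
    ((theta Q).ker : Set (lipPoints Q)) = {1, toPoint Q w} := by
  have hwk : toPoint Q w ∈ (theta Q).ker := toPoint_mem_ker_theta.2 (Or.inr hw)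
  refine Set.Subset.antisymm (fun P hP => ?_)
    (Set.insert_subset (one_mem _) (Set.singleton_subset_iff.2 hwk))
  obtain ⟨u, rfl⟩ := toPoint_surjective Q P
  rcases mem_weakScalars.1 (toPoint_mem_ker_theta.1 hP) with h | h
  · exact Or.inl (toPoint_eq_one_of_xi_eq_one hB (Subtype.ext h))
  · right
    have huw : xi Q u = xi Q w := Subtype.ext (h.trans hw.symm)
    have h1 := toPoint_eq_one_of_xi_eq_one hB (u := u * w⁻¹) (by
      rw [map_mul, map_inv, huw, mul_inv_cancel])
    rw [map_mul, map_inv] at h1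
    exact mul_inv_eq_one.1 h1

/-- A product of pairwise orthogonal non-singular vectors acts as the product of the commuting
reflections. -/
theorem exists_lipGroup_list_prod (l : List V) (hl : ∀ v ∈ l, Q v ≠ 0)
    (horth : l.Pairwise fun v w => polarForm Q v w = 0) :
    ∃ u : lipGroup Q, ((u : (CliffordAlgebra Q)ˣ) : CliffordAlgebra Q) = (l.map (ι Q)).prod ∧
      (∀ v ∈ l, (xi Q u : V ≃ₗ[F] V) v = -v) ∧
      ∀ x, (∀ v ∈ l, polarForm Q v x = 0) → (xi Q u : V ≃ₗ[F] V) x = x := by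
  induction l with
  | nil => exact ⟨1, rfl, by simp, fun x _ => by rw [map_one]; rfl⟩
  | cons v l ih =>
    obtain ⟨u, hu, hneg, hfix⟩ := ih (fun w hw => hl w (List.mem_cons_of_mem v hw))
      (List.pairwise_cons.1 horth).2
    obtain ⟨r, hr, hrx⟩ := exists_lipGroup_reflection (hl v List.mem_cons_self)
    have hmul : ∀ x, (xi Q (r * u) : V ≃ₗ[F] V) x =
        (xi Q r : V ≃ₗ[F] V) ((xi Q u : V ≃ₗ[F] V) x) := fun x => by rw [map_mul]; rfl
    have hv := (List.pairwise_cons.1 horth).1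
    refine ⟨r * u, ?_, fun w hw => ?_, fun x hx => ?_⟩
    · rw [List.map_cons, List.prod_cons, ← hr, ← hu]; rfl
    -- The remaining factors fix the head because they are orthogonal to it; its own reflection then
    -- negates it, as `B(w, w) / Q(w) = 2`.
    · rcases List.mem_cons.1 hw with rfl | hw
      · have h2 : polarForm Q w w / Q w = 2 := by
          rw [polarForm_self, mul_div_cancel_right₀ _ (hl w List.mem_cons_self)]
        rw [hmul, hfix w fun z hz => by rw [polarForm_comm]; exact hv z hz, hrx, h2, two_smul]
        abel
      · rw [hmul, hneg w hw, hrx, map_neg, hv w hw]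
        simp
    · rw [hmul, hfix x fun w hw => hx w (List.mem_cons_of_mem v hw), hrx,
        hx v List.mem_cons_self]
      simp

theorem list_prod_ι_mem_evenOdd (l : List V) :
    (l.map (ι Q)).prod ∈ evenOdd Q (l.length : ZMod 2) := by
  induction l with
  | nil =>
    rw [List.length_nil, Nat.cast_zero]
    exact one_le_evenOdd_zero Q (Submodule.one_le.1 le_rfl)
  | cons v l ih =>
    rw [List.map_cons, List.prod_cons, List.length_cons, Nat.cast_add, Nat.cast_one, add_comm]
    exact evenOdd_mul_le Q _ _ (Submodule.mul_mem_mul (ι_mem_evenOdd_one Q v) ih)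

theorem vecProd_eq_list_prod {m : ℕ} (e : Fin m → V) :
    vecProd Q e = ((List.ofFn e).map (ι Q)).prod := by
  rw [vecProd, List.map_ofFn]; rfl

theorem vecProd_mem_evenOdd {m : ℕ} (e : Fin m → V) : vecProd Q e ∈ evenOdd Q (m : ZMod 2) := by
  have h := list_prod_ι_mem_evenOdd (Q := Q) (List.ofFn e)
  rwa [List.length_ofFn, ← vecProd_eq_list_prod] at h

/-- A singular basis vector would be orthogonal to the whole basis, itself included since `B(e_i,
e_i) = 2 Q(e_i)`, against `V^⊥ = 0`. So all the reflections exist, and their product negates every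
basis vector. -/
theorem exists_lipGroup_vecProd (hB : perpSpace Q = ⊥) {m : ℕ} (e : Module.Basis (Fin m) F V)
    (he : ∀ i j, i ≠ j → polarForm Q (e i) (e j) = 0) :
    ∃ u : lipGroup Q, ((u : (CliffordAlgebra Q)ˣ) : CliffordAlgebra Q) = vecProd Q e ∧
      (xi Q u : V ≃ₗ[F] V) = LinearEquiv.neg F := by
  have hne : ∀ i, Q (e i) ≠ 0 := by
    intro i h
    obtain ⟨y, hy⟩ := exists_polarForm_ne_zero hB (e.ne_zero i)
    refine hy ?_
    have : polarForm Q (e i) = 0 := e.ext fun j => by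
      rcases eq_or_ne i j with rfl | hij
      · rw [polarForm_self, h, mul_zero]; rfl
      · exact he i j hij
    rw [this, LinearMap.zero_apply]
  obtain ⟨u, hu, hneg, -⟩ := exists_lipGroup_list_prod (Q := Q) (List.ofFn e)
    (by
      intro v hv
      obtain ⟨i, rfl⟩ := List.mem_ofFn.1 hv
      exact hne i)
    (List.pairwise_ofFn.2 fun i j hij => he i j hij.ne)
  refine ⟨u, hu.trans (vecProd_eq_list_prod e).symm, ?_⟩
  have : (xi Q u : V ≃ₗ[F] V).toLinearMap = (LinearEquiv.neg F : V ≃ₗ[F] V).toLinearMap :=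
    e.ext fun i => hneg (e i) (List.mem_ofFn.2 ⟨i, rfl⟩)
  exact LinearEquiv.toLinearMap_injective this

end Kernel

/-! ### Nonsingular vectors and orthogonal bases -/

theorem exists_apply_ne_zero [FiniteDimensional F V] {Q : QuadraticForm F V}
    (hB : perpSpace Q = ⊥) (hV : 0 < Module.finrank F V) : ∃ v, Q v ≠ 0 := by
  by_contra! h
  have := Module.finrank_pos_iff.1 hV
  obtain ⟨x, hx⟩ := exists_ne (0 : V)
  obtain ⟨y, hy⟩ := exists_polarForm_ne_zero hB hx
  -- If `Q` vanished identically, so would its polar form.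
  have h1 := apply_add_eq Q x y
  rw [h, h, h, zero_add, zero_add] at h1
  exact hy h1.symm

theorem exists_orthogonal_basis_polarForm [FiniteDimensional F V] (Q : QuadraticForm F V)
    (h2 : ringChar F ≠ 2) : ∃ e : Module.Basis (Fin (Module.finrank F V)) F V,
      ∀ i j, i ≠ j → polarForm Q (e i) (e j) = 0 := by
  have : Invertible (2 : F) := invertibleOfNonzero (Ring.two_ne_zero h2)
  obtain ⟨e, he⟩ := LinearMap.BilinForm.exists_orthogonal_basis (B := polarForm Q)
    ⟨fun x y => polarForm_comm Q x y⟩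
  exact ⟨e, fun i j hij => he hij⟩

end ProjMetric

/-! ### The main theorem -/

open ProjMetric in
theorem theorem5p1 {F V : Type*} [Field F] [AddCommGroup V] [Module F V] [FiniteDimensional F V]
    (Q : QuadraticForm F V) (hQ : Module.finrank F (perpSpace Q) = 0) :
    -- `θ` is a surjective homomorphism
    Function.Surjective (theta Q) ∧
    -- dimension zero
    (Module.finrank F V = 0 →
      ((theta Q).ker : Set (lipPoints Q)) = {1} ∧
      lipPointsGraded Q 0 = Set.univ ∧
      theta Q '' lipPointsGraded Q 0 = Set.univ) ∧
    -- positive dimension, characteristic two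
    (0 < Module.finrank F V → ringChar F = 2 →
      ((theta Q).ker : Set (lipPoints Q)) = {1} ∧
      theta Q '' lipPointsGraded Q 0 ≠ Set.univ) ∧
    -- positive dimension, characteristic different from two: the kernel in terms of an
    -- orthogonal basis
    (0 < Module.finrank F V → ringChar F ≠ 2 →
      (∃ e : Module.Basis (Fin (Module.finrank F V)) F V,
        ∀ i j, i ≠ j → polarForm Q (e i) (e j) = 0) ∧
      ∀ e : Module.Basis (Fin (Module.finrank F V)) F V,
        (∀ i j, i ≠ j → polarForm Q (e i) (e j) = 0) →
        ∃ P : lipPoints Q,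
          lipPoints.toSubmodule P = Submodule.span F {vecProd Q e} ∧
          P ≠ 1 ∧ ((theta Q).ker : Set (lipPoints Q)) = {1, P} ∧
          1 ∈ lipPointsGraded Q 0 ∧
          (Odd (Module.finrank F V) → P ∈ lipPointsGraded Q 1) ∧
          (Even (Module.finrank F V) → P ∈ lipPointsGraded Q 0)) ∧
    -- the image of the even points, odd dimension
    (Odd (Module.finrank F V) → ringChar F ≠ 2 →
      theta Q '' lipPointsGraded Q 0 = Set.univ) ∧
    -- the image of the even points, positive even dimension
    (0 < Module.finrank F V → Even (Module.finrank F V) → ringChar F ≠ 2 →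
      theta Q '' lipPointsGraded Q 0 ≠ Set.univ) := by
  have hB : perpSpace Q = ⊥ := Submodule.finrank_eq_zero.1 hQ
  have hsurj := theta_surjective hB
  -- Both parities at once: the degree of `Fe` is `dim V` modulo 2. Positive dimension is needed
  -- only to separate `Fe` from `F1`.
  have hmain : ringChar F ≠ 2 → ∀ e : Module.Basis (Fin (Module.finrank F V)) F V,
      (∀ i j, i ≠ j → polarForm Q (e i) (e j) = 0) →
      ∃ P : lipPoints Q, lipPoints.toSubmodule P = Submodule.span F {vecProd Q e} ∧
        (0 < Module.finrank F V → P ≠ 1) ∧ ((theta Q).ker : Set (lipPoints Q)) = {1, P} ∧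
        P ∈ lipPointsGraded Q (Module.finrank F V : ZMod 2) := by
    intro h2 e he
    obtain ⟨w, hw, hneg⟩ := exists_lipGroup_vecProd hB e he
    refine ⟨toPoint Q w, by rw [toSubmodule_toPoint, hw], fun hV h1 => ?_,
      ker_theta_eq_pair hB hneg, ?_⟩
    -- If `Fe = F1`, then `ξ_e` is both `id` and `-id`, so `2x = 0` for a nonzero `x`.
    · have := Module.finrank_pos_iff.1 hV
      obtain ⟨x, hx⟩ := exists_ne (0 : V)
      obtain ⟨c, hc⟩ := mem_ker_toPoint.1 h1
      have hfix : (xi Q w : V ≃ₗ[F] V) x = x := xi_apply_eq_of_mul_ι_eq w (by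
        rw [hc, AlgHom.commutes, Algebra.commutes])
      rw [hneg] at hfix
      have hxx : (2 : F) • x = 0 := by
        rw [two_smul]
        nth_rewrite 1 [← hfix]
        exact neg_add_cancel x
      exact (smul_ne_zero (Ring.two_ne_zero h2) hx) hxx
    · rw [toPoint_mem_lipPointsGraded, hw]
      exact vecProd_mem_evenOdd e
  have hcastOdd : Odd (Module.finrank F V) → (Module.finrank F V : ZMod 2) = 1 :=
    fun h => ZMod.natCast_eq_one_iff_odd.2 h
  have hcastEven : Even (Module.finrank F V) → (Module.finrank F V : ZMod 2) = 0 :=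
    fun h => ZMod.natCast_eq_zero_iff_even.2 h
  refine ⟨hsurj, fun hV => ?_, fun hV h2 => ?_, fun hV h2 =>
    ⟨exists_orthogonal_basis_polarForm Q h2, fun e he => ?_⟩, fun hodd h2 => ?_, fun hV heven h2 => ?_⟩
  · have := Module.finrank_zero_iff.1 hV
    have hker : ((theta Q).ker : Set (lipPoints Q)) = {1} :=
      ker_theta_eq_singleton hB fun x => Subsingleton.elim _ _
    have huniv : lipPointsGraded Q 0 = Set.univ := by
      refine Set.eq_univ_of_forall fun P => ?_
      obtain ⟨u, rfl⟩ := toPoint_surjective Q P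
      -- On the zero space every `ξ_u` is the identity, so every point lies in the kernel.
      have hu : toPoint Q u ∈ ((theta Q).ker : Set (lipPoints Q)) :=
        toPoint_mem_ker_theta.2 (Or.inl (LinearEquiv.ext fun x => Subsingleton.elim _ _))
      rw [hker] at hu
      rw [Set.mem_singleton_iff.1 hu]
      exact one_mem_lipPointsGraded
    refine ⟨hker, huniv, ?_⟩
    rw [huniv, Set.image_univ, hsurj.range_eq]
  · have := ringChar.of_eq h2
    have hker : ((theta Q).ker : Set (lipPoints Q)) = {1} :=
      ker_theta_eq_singleton hB fun x => by
        rw [← neg_one_smul F x, CharTwo.neg_eq, one_smul]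
    refine ⟨hker, ?_⟩
    obtain ⟨v, hv⟩ := exists_apply_ne_zero hB hV
    refine theta_image_ne_univ (fun P hP => ?_) hv
    have hP1 : P ∈ ((theta Q).ker : Set (lipPoints Q)) := hP
    rw [hker] at hP1
    rw [Set.mem_singleton_iff.1 hP1]
    exact one_mem_lipPointsGraded
  · obtain ⟨P, hP, hP1, hker, hgr⟩ := hmain h2 e he
    exact ⟨P, hP, hP1 hV, hker, one_mem_lipPointsGraded, fun h => hcastOdd h ▸ hgr,
      fun h => hcastEven h ▸ hgr⟩
  · obtain ⟨e, he⟩ := exists_orthogonal_basis_polarForm Q h2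
    obtain ⟨P, -, -, hker, hgr⟩ := hmain h2 e he
    rw [hcastOdd hodd] at hgr
    exact theta_image_eq_univ hsurj (hker.ge (Or.inr rfl)) hgr
  · obtain ⟨e, he⟩ := exists_orthogonal_basis_polarForm Q h2
    obtain ⟨P, -, -, hker, hgr⟩ := hmain h2 e he
    rw [hcastEven heven] at hgr
    obtain ⟨v, hv⟩ := exists_apply_ne_zero hB hV
    refine theta_image_ne_univ (fun R hR => ?_) hv
    rcases hker.le hR with rfl | rfl
    · exact one_mem_lipPointsGraded
    · exact hgr
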